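/- Recall that a convex body in $\mathbb R^3$ is a non-empty compact convex subset of $\mathbb R^3$, and that $K+L=\{p+q : p\in K,\ q\in L\}$ is the Minkowski sum. A zonotope is a Minkowski sum of finitely many segments (possibly degenerate), and a zonoid is a convex body that is the limit of a sequence of zonotopes in the Hausdorff metric. The mixed volume of convex bodies $A,B,C\subset\mathbb R^3$ is the unique symmetric functional $V(A,B,C)$ that is Minkowski-linear in each argument and satisfies $V(A,A,A)=\mathrm{Vol}_3(A)$; explicitly, $$6\,V(A,B,C)=\mathrm{Vol}_3(A+B+C)-\mathrm{Vol}_3(A+B)-\mathrm{Vol}_3(A+C)-\mathrm{Vol}_3(B+C)+\mathrm{Vol}_3(A)+\mathrm{Vol}_3(B)+\mathrm{Vol}_3(C).$$ **Theorem.** For all zonoids $A,B,C\subset\mathbb R^3$, $$V(A,A,A)\,V(A,B,C)\;\le\;\tfrac32\,V(A,A,B)\,V(A,A,C).$$ -/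

import Mathlib

open Filter Topology MeasureTheory
open scoped Pointwise

/-- Euclidean three-space. -/
abbrev E3 : Type := EuclideanSpace ℝ (Fin 3)

/-- The three-dimensional volume of a convex body in `ℝ³`, as a real number
(a convex body is compact, so its Lebesgue measure is finite). -/
noncomputable def bodyVol (K : ConvexBody E3) : ℝ :=
  (volume : Measure E3).real (K : Set E3)

/-- The mixed volume of three convex bodies in `ℝ³`, given by the polarization formula
`3! V(A,B,C) = ∑_{∅ ≠ S ⊆ {A,B,C}} (-1)^{3 - |S|} Vol(∑_{K ∈ S} K)`, where `+` is the Minkowski sum. -/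
noncomputable def mixedVolume (A B C : ConvexBody E3) : ℝ :=
  (bodyVol (A + B + C) - bodyVol (A + B) - bodyVol (A + C) - bodyVol (B + C)
    + bodyVol A + bodyVol B + bodyVol C) / 6

/-- A zonotope: the Minkowski sum of finitely many segments. -/
def IsZonotope (K : ConvexBody E3) : Prop :=
  ∃ (m : ℕ) (a b : Fin m → E3), (K : Set E3) = ∑ i, segment ℝ (a i) (b i)

/-- A zonoid: the limit of a sequence of zonotopes in the Hausdorff metric
(which is the metric that `ConvexBody` carries). -/
def IsZonoid (K : ConvexBody E3) : Prop :=
  ∃ Z : ℕ → ConvexBody E3, (∀ n, IsZonotope (Z n)) ∧ Tendsto Z atTop (𝓝 K)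

/-- A symmetric, Minkowski-additive functional of three convex bodies that is the volume on the
diagonal can only be `mixedVolume`: this is the usual characterization of the mixed volume. -/
theorem eq_mixedVolume_of_symm_of_additive_of_diag
    (V : ConvexBody E3 → ConvexBody E3 → ConvexBody E3 → ℝ)
    (symm₁₂ : ∀ A B C, V A B C = V B A C) (symm₂₃ : ∀ A B C, V A B C = V A C B)
    (add : ∀ A A' B C, V (A + A') B C = V A B C + V A' B C)
    (diag : ∀ A, V A A A = bodyVol A) (A B C : ConvexBody E3) :
    V A B C = mixedVolume A B C := by
  have add₂ : ∀ A B B' C, V A (B + B') C = V A B C + V A B' C := fun A B B' C => by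
    rw [symm₁₂, add, symm₁₂ B, symm₁₂ B']
  have add₃ : ∀ A B C C', V A B (C + C') = V A B C + V A B C' := fun A B C C' => by
    rw [symm₂₃, add₂, symm₂₃ A C, symm₂₃ A C']
  have e1 : V B A C = V A B C := symm₁₂ _ _ _
  have e2 : V A C B = V A B C := (symm₂₃ _ _ _).symm
  have e3 : V B C A = V A B C := by rw [symm₂₃, e1]
  have e4 : V C A B = V A B C := by rw [symm₁₂, e2]
  have e5 : V C B A = V A B C := by rw [symm₁₂, e3]
  simp only [mixedVolume, ← diag, add, add₂, add₃, e1, e2, e3, e4, e5]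
  ring

/-! For zonotopes, `V(A,B,C)` is one sixth of the sum of `|det(x, y, z)|` over generators of `A`,
`B`, `C` (`mixedVolume_of_eq_zonotopeAt`). This is additive in `B` and `C` separately, so both may
be taken to be segments `u`, `v` (`sum_abs_det3_vec_le`). In a basis beginning with `u`, `v`,
generators with nonzero third coordinate can be scaled to height one, the absolute third coordinates
becoming weights. What remains is a planar inequality for weighted points (`areaSum_le`): total mass
times triangle areas against the mean distances in the two coordinates.

A layer-cake decomposition of each coordinate (`areaSum_le_of_layers`) reduces it to masses at the
vertices of the unit square, where the difference of the two sides is six times a square.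

Zonoids follow by continuity of volume along zonotope sequences (`tendsto_bodyVol`). -/

/-! ### The planar inequality on the unit square. -/

/-- Twice the signed area of the triangle with vertices `(a i, b i)`, `(a j, b j)`, `(a k, b k)`. -/
def signedArea {ι : Type*} (a b : ι → ℝ) (i j k : ι) : ℝ :=
  (a j - a i) * (b k - b i) - (a k - a i) * (b j - b i)

/-- The weighted sum of the distances between the values of `a`. -/
def spread {ι : Type*} [Fintype ι] (w a : ι → ℝ) : ℝ :=
  ∑ i, ∑ j, w i * w j * |a i - a j|

/-- The weighted sum of the areas of all triangles with vertices among the points `(a i, b i)`. -/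
def areaSum {ι : Type*} [Fintype ι] (w a b : ι → ℝ) : ℝ :=
  ∑ i, ∑ j, ∑ k, w i * w j * w k * |signedArea a b i j k|

theorem signedArea_swap {ι : Type*} (a b : ι → ℝ) (i j k : ι) :
    signedArea b a i j k = -signedArea a b i j k := by
  simp only [signedArea]; ring

theorem areaSum_comm {ι : Type*} [Fintype ι] (w a b : ι → ℝ) :
    areaSum w a b = areaSum w b a := by
  simp only [areaSum, signedArea_swap a b, abs_neg]

theorem sum_mul_comp_eq_sum_fiber {ι κ : Type*} [Fintype ι] [Fintype κ] [DecidableEq κ]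
    (w : ι → ℝ) (c : ι → κ) (f : κ → ℝ) :
    ∑ i, w i * f (c i) = ∑ q, (∑ i with c i = q, w i) * f q := by
  rw [← Finset.sum_fiberwise Finset.univ c]
  refine Finset.sum_congr rfl fun q _ => ?_
  rw [Finset.sum_mul]
  refine Finset.sum_congr rfl fun i hi => ?_
  rw [(Finset.mem_filter.1 hi).2]

/-- The planar inequality for points at the vertices of the unit square. -/
theorem areaSum_le_of_zero_one {ι : Type*} [Fintype ι] {w : ι → ℝ}
    {a b : ι → ℝ} (ha : ∀ i, a i = 0 ∨ a i = 1) (hb : ∀ i, b i = 0 ∨ b i = 1) :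
    (∑ i, w i) * areaSum w a b ≤ 3 / 2 * spread w b * spread w a := by
  classical
  let c : ι → Bool × Bool := fun i => (decide (a i = 1), decide (b i = 1))
  let g : Bool → ℝ := fun t => if t then 1 else 0
  have hag : ∀ i, a i = g (c i).1 := fun i => by
    rcases ha i with h | h <;> simp [g, c, h]
  have hbg : ∀ i, b i = g (c i).2 := fun i => by
    rcases hb i with h | h <;> simp [g, c, h]
  -- Both sides depend only on the four vertex masses `p`.
  let p : Bool × Bool → ℝ := fun q => ∑ i with c i = q, w i
  have h0 : ∑ i, w i = ∑ q, p q := by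
    simpa using sum_mul_comp_eq_sum_fiber w c (fun _ => 1)
  have h1 : ∀ f : Bool × Bool → Bool × Bool → ℝ,
      ∑ i, ∑ j, w i * w j * f (c i) (c j) = ∑ q, ∑ r, p q * p r * f q r := by
    intro f
    simp_rw [mul_assoc, ← Finset.mul_sum, sum_mul_comp_eq_sum_fiber w c]
    exact sum_mul_comp_eq_sum_fiber w c fun q => ∑ r, p r * f q r
  have h2 : ∀ f : Bool × Bool → Bool × Bool → Bool × Bool → ℝ,
      ∑ i, ∑ j, ∑ k, w i * w j * w k * f (c i) (c j) (c k)
        = ∑ q, ∑ r, ∑ s, p q * p r * p s * f q r s := by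
    intro f
    simp_rw [mul_assoc, ← Finset.mul_sum]
    rw [← sum_mul_comp_eq_sum_fiber w c fun q => ∑ r, p r * ∑ s, p s * f q r s]
    refine Finset.sum_congr rfl fun i _ => congrArg _ ?_
    rw [← sum_mul_comp_eq_sum_fiber w c fun r => ∑ s, p s * f (c i) r s]
    refine Finset.sum_congr rfl fun j _ => congrArg _ ?_
    exact sum_mul_comp_eq_sum_fiber w c fun s => f (c i) (c j) s
  have ea := h1 fun q r => |g q.1 - g r.1|
  have eb := h1 fun q r => |g q.2 - g r.2|
  have eab := h2 fun q r s =>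
    |(g r.1 - g q.1) * (g s.2 - g q.2) - (g s.1 - g q.1) * (g r.2 - g q.2)|
  simp only [areaSum, spread, signedArea, hag, hbg]
  rw [ea, eb, eab, h0]
  simp only [Fintype.sum_prod_type, Fintype.sum_bool, g]
  norm_num
  -- The right side minus the left is exactly six times this square, so no sign of `w` matters.
  nlinarith [sq_nonneg (p (true, true) * p (false, false) - p (true, false) * p (false, true))]

/-! ### Reduction to 0/1-valued coordinates. -/

section Layers

variable {ι : Type*}

/-- The indicator of the superlevel set of `a` at level `s`. -/
noncomputable def layer (a : ι → ℝ) (s : ℝ) (i : ι) : ℝ := (Set.Iio (a i)).indicator 1 s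

theorem layer_eq (a : ι → ℝ) (s : ℝ) (i : ι) : layer a s i = if s < a i then 1 else 0 := by
  simp [layer, Set.indicator_apply]

theorem integrable_layer (a : ι → ℝ) (M : ℝ) (i : ι) :
    Integrable (fun s => layer a s i) (volume.restrict (Set.Ioc (-M) M)) :=
  (integrable_const (1 : ℝ)).indicator measurableSet_Iio

theorem integral_layer {a : ι → ℝ} {M : ℝ} {i : ι} (h : |a i| ≤ M) :
    ∫ s in Set.Ioc (-M) M, layer a s i = a i + M := by
  have h' := abs_le.1 h
  simp only [layer]
  rw [integral_indicator_one measurableSet_Iio, measureReal_restrict_apply measurableSet_Iio,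
    show Set.Iio (a i) ∩ Set.Ioc (-M) M = Set.Ioo (-M) (a i) by
      ext s; simp only [Set.mem_inter_iff, Set.mem_Iio, Set.mem_Ioc, Set.mem_Ioo]
      constructor <;> intro h <;> refine ⟨?_, ?_⟩ <;> try constructor
      all_goals linarith [h.1, h.2]]
  rw [Real.volume_real_Ioo_of_le (by linarith)]
  ring

theorem integral_layer_sub {a : ι → ℝ} {M : ℝ} (h : ∀ i, |a i| ≤ M) (i j : ι) :
    ∫ s in Set.Ioc (-M) M, (layer a s i - layer a s j) = a i - a j := by
  rw [integral_sub (integrable_layer a M i) (integrable_layer a M j), integral_layer (h i),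
    integral_layer (h j)]
  ring

/-- Superlevel sets are nested, so the integrand before taking absolute values has the same sign at
every level. -/
theorem integral_abs_layer_sub {a : ι → ℝ} {M : ℝ} (h : ∀ i, |a i| ≤ M) (i j : ι) :
    ∫ s in Set.Ioc (-M) M, |layer a s i - layer a s j| = |a i - a j| := by
  wlog hij : a j ≤ a i generalizing i j
  · simp_rw [abs_sub_comm (layer a _ i)]
    rw [this j i (le_of_not_ge hij), abs_sub_comm]
  rw [abs_of_nonneg (sub_nonneg.2 hij), ← integral_layer_sub h i j]
  congr 1
  ext s
  rw [abs_of_nonneg]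
  simp only [layer_eq]
  split_ifs <;> linarith

/-- For fixed `b` the signed area is linear in the differences of `a`, so it is the integral of its
layers; cancellation between layers can only lower the left side. -/
theorem abs_signedArea_le_integral {a : ι → ℝ} (b : ι → ℝ) {M : ℝ} (h : ∀ i, |a i| ≤ M)
    (i j k : ι) :
    |signedArea a b i j k| ≤ ∫ s in Set.Ioc (-M) M, |signedArea (layer a s) b i j k| := by
  have hi : ∀ i j, Integrable (fun s => layer a s i - layer a s j)
      (volume.restrict (Set.Ioc (-M) M)) :=
    fun i j => (integrable_layer a M i).sub (integrable_layer a M j)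
  have : signedArea a b i j k = ∫ s in Set.Ioc (-M) M, signedArea (layer a s) b i j k := by
    simp only [signedArea]
    rw [integral_sub ((hi j i).mul_const _) ((hi k i).mul_const _), integral_mul_const,
      integral_mul_const, integral_layer_sub h, integral_layer_sub h]
  rw [this]
  exact abs_integral_le_integral_abs

/-- Under the layer decomposition `spread` is preserved exactly while `areaSum` can only grow, so
integrating the 0/1 case over the levels suffices. -/
theorem areaSum_le_of_layers [Fintype ι] {w : ι → ℝ} (hw : ∀ i, 0 ≤ w i) (b : ι → ℝ) {W R : ℝ} (hW : 0 ≤ W)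
    (H : ∀ a : ι → ℝ, (∀ i, a i = 0 ∨ a i = 1) → W * areaSum w a b ≤ R * spread w a)
    (a : ι → ℝ) : W * areaSum w a b ≤ R * spread w a := by
  let M := ∑ i, |a i|
  have hM : ∀ i, |a i| ≤ M := fun i =>
    Finset.single_le_sum (f := fun i => |a i|) (fun i _ => abs_nonneg _) (Finset.mem_univ i)
  have hi : ∀ i j, Integrable (fun s => layer a s i - layer a s j)
      (volume.restrict (Set.Ioc (-M) M)) :=
    fun i j => (integrable_layer a M i).sub (integrable_layer a M j)
  have h1 : ∀ i j, Integrable (fun s => w i * w j * |layer a s i - layer a s j|)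
      (volume.restrict (Set.Ioc (-M) M)) := fun i j => (hi i j).abs.const_mul _
  have h2 : ∀ i j k, Integrable (fun s => w i * w j * w k * |signedArea (layer a s) b i j k|)
      (volume.restrict (Set.Ioc (-M) M)) := fun i j k =>
    (((hi j i).mul_const _).sub ((hi k i).mul_const _)).abs.const_mul _
  have e1 : spread w a = ∫ s in Set.Ioc (-M) M, spread w (layer a s) := by
    simp only [spread]
    rw [integral_finsetSum _ fun i _ => integrable_finsetSum _ fun j _ => h1 i j]
    refine Finset.sum_congr rfl fun i _ => ?_
    rw [integral_finsetSum _ fun j _ => h1 i j]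
    refine Finset.sum_congr rfl fun j _ => ?_
    rw [integral_const_mul, integral_abs_layer_sub hM]
  have i1 : Integrable (fun s => spread w (layer a s)) (volume.restrict (Set.Ioc (-M) M)) :=
    integrable_finsetSum _ fun i _ => integrable_finsetSum _ fun j _ => h1 i j
  have i2 : Integrable (fun s => areaSum w (layer a s) b) (volume.restrict (Set.Ioc (-M) M)) :=
    integrable_finsetSum _ fun i _ => integrable_finsetSum _ fun j _ =>
      integrable_finsetSum _ fun k _ => h2 i j k
  have e2 : areaSum w a b ≤ ∫ s in Set.Ioc (-M) M, areaSum w (layer a s) b := by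
    simp only [areaSum]
    rw [integral_finsetSum _ fun i _ => integrable_finsetSum _ fun j _ =>
      integrable_finsetSum _ fun k _ => h2 i j k]
    refine Finset.sum_le_sum fun i _ => ?_
    rw [integral_finsetSum _ fun j _ => integrable_finsetSum _ fun k _ => h2 i j k]
    refine Finset.sum_le_sum fun j _ => ?_
    rw [integral_finsetSum _ fun k _ => h2 i j k]
    refine Finset.sum_le_sum fun k _ => ?_
    rw [integral_const_mul]
    exact mul_le_mul_of_nonneg_left (abs_signedArea_le_integral b hM i j k)
      (mul_nonneg (mul_nonneg (hw i) (hw j)) (hw k))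
  calc W * areaSum w a b ≤ W * ∫ s in Set.Ioc (-M) M, areaSum w (layer a s) b :=
        mul_le_mul_of_nonneg_left e2 hW
    _ = ∫ s in Set.Ioc (-M) M, W * areaSum w (layer a s) b := (integral_const_mul _ _).symm
    _ ≤ ∫ s in Set.Ioc (-M) M, R * spread w (layer a s) :=
        integral_mono (i2.const_mul _) (i1.const_mul _) fun s => H _ fun i => by
          rw [layer_eq]; split_ifs <;> simp
    _ = R * spread w a := by rw [integral_const_mul, e1]

end Layers

/-- The mean area of a random triangle in the plane is at most `3 / 4` times the product of the
mean distances between the projections of two random points to the coordinate axes. -/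
theorem areaSum_le {ι : Type*} [Fintype ι] {w : ι → ℝ} (hw : ∀ i, 0 ≤ w i) (a b : ι → ℝ) :
    (∑ i, w i) * areaSum w a b ≤ 3 / 2 * spread w a * spread w b := by
  have hW : 0 ≤ ∑ i, w i := Finset.sum_nonneg fun i _ => hw i
  rw [areaSum_comm]
  -- One coordinate is layered at a time; the spread of the other is absorbed into the constant `R`.
  refine areaSum_le_of_layers hw a hW (fun b hb => ?_) b
  rw [areaSum_comm, mul_right_comm]
  refine areaSum_le_of_layers hw b hW (fun a ha => ?_) a
  exact areaSum_le_of_zero_one ha hb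

/-! ### From the plane to determinants in space. -/

/-- The determinant of three vectors in `ℝ³`. -/
def det3 (x y z : Fin 3 → ℝ) : ℝ := (Matrix.of ![x, y, z]).det

theorem det3_eq (x y z : Fin 3 → ℝ) :
    det3 x y z = x 0 * (y 1 * z 2 - y 2 * z 1) - x 1 * (y 0 * z 2 - y 2 * z 0)
      + x 2 * (y 0 * z 1 - y 1 * z 0) := by
  rw [det3, Matrix.det_fin_three]
  simp only [Matrix.of_apply, Matrix.cons_val]
  ring

/-- Volume times length of a projection is at most the product of the areas of two projections,
for a zonotope whose generators are not horizontal. -/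
theorem sum_abs_det3_coord_le_of_ne_zero {ι : Type*} [Fintype ι] (c : ι → Fin 3 → ℝ)
    (hc : ∀ i, c i 2 ≠ 0) :
    (∑ i, ∑ j, ∑ k, |det3 (c i) (c j) (c k)|) * ∑ i, |c i 2| ≤
      3 / 2 * ((∑ i, ∑ j, |c i 1 * c j 2 - c i 2 * c j 1|) *
        ∑ i, ∑ j, |c i 0 * c j 2 - c i 2 * c j 0|) := by
  -- Each generator is `c i 2` times a point at height one; `|c i 2|` is its weight.
  have key : ∀ l, ∑ i, ∑ j, |c i l * c j 2 - c i 2 * c j l|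
      = spread (fun i => |c i 2|) fun i => c i l / c i 2 := fun l => by
    refine Finset.sum_congr rfl fun i _ => Finset.sum_congr rfl fun j _ => ?_
    rw [← abs_mul, ← abs_mul]
    congr 1
    have hi := hc i
    have hj := hc j
    field_simp
  have key' : ∑ i, ∑ j, ∑ k, |det3 (c i) (c j) (c k)|
      = areaSum (fun i => |c i 2|) (fun i => c i 0 / c i 2) fun i => c i 1 / c i 2 := by
    refine Finset.sum_congr rfl fun i _ => Finset.sum_congr rfl fun j _ =>
      Finset.sum_congr rfl fun k _ => ?_
    rw [← abs_mul, ← abs_mul, ← abs_mul]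
    congr 1
    have hi := hc i
    have hj := hc j
    have hk := hc k
    rw [det3_eq, signedArea]
    field_simp
    ring
  rw [key, key, key', mul_comm]
  refine (areaSum_le (fun i => abs_nonneg _) _ _).trans_eq ?_
  ring

/-- Adding a small `ε > 0` to all third coordinates makes them nonzero; both sides are continuous in
`ε`. -/
theorem sum_abs_det3_coord_le {ι : Type*} [Fintype ι] (c : ι → Fin 3 → ℝ) :
    (∑ i, ∑ j, ∑ k, |det3 (c i) (c j) (c k)|) * ∑ i, |c i 2| ≤
      3 / 2 * ((∑ i, ∑ j, |c i 1 * c j 2 - c i 2 * c j 1|) *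
        ∑ i, ∑ j, |c i 0 * c j 2 - c i 2 * c j 0|) := by
  let d : ℝ → ι → Fin 3 → ℝ := fun ε i l => c i l + if l = 2 then ε else 0
  have hd : ∀ᶠ ε in 𝓝[>] (0 : ℝ), ∀ i, d ε i 2 ≠ 0 := by
    refine eventually_all.2 fun i => ?_
    rcases eq_or_ne (c i 2) 0 with h | h
    · filter_upwards [self_mem_nhdsWithin] with ε hε
      simpa [d, h] using (ne_of_gt hε)
    · have : ContinuousAt (fun ε : ℝ => d ε i 2) 0 := by
        simp only [d, if_true]; fun_prop
      exact (this.eventually_ne (by simpa [d] using h)).filter_mono nhdsWithin_le_nhds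
  have cont : ∀ i l, Continuous fun ε => d ε i l := fun i l => by
    simp only [d]; split_ifs <;> fun_prop
  have d0 : d 0 = c := by ext i l; simp [d]
  have h1 : Continuous fun ε =>
      (∑ i, ∑ j, ∑ k, |det3 (d ε i) (d ε j) (d ε k)|) * ∑ i, |d ε i 2| := by
    simp only [det3_eq]; fun_prop
  have h2 : Continuous fun ε => 3 / 2 * ((∑ i, ∑ j, |d ε i 1 * d ε j 2 - d ε i 2 * d ε j 1|) *
        ∑ i, ∑ j, |d ε i 0 * d ε j 2 - d ε i 2 * d ε j 0|) := by
    fun_prop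
  have := le_of_tendsto_of_tendsto ((h1.tendsto 0).mono_left nhdsWithin_le_nhds)
    ((h2.tendsto 0).mono_left nhdsWithin_le_nhds)
    (hd.mono fun ε hε => sum_abs_det3_coord_le_of_ne_zero (d ε) hε)
  simpa only [d0] using this

/-- This is the case where `B` and `C` are segments: coordinates in the basis `u`, `v`, `u × v` turn
it into the coordinate inequality. -/
theorem sum_abs_det3_vec_le {ι : Type*} [Fintype ι] (x : ι → Fin 3 → ℝ) (u v : Fin 3 → ℝ) :
    (∑ i, ∑ j, ∑ k, |det3 (x i) (x j) (x k)|) * ∑ i, |det3 (x i) u v| ≤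
      3 / 2 * ((∑ i, ∑ j, |det3 (x i) (x j) u|) * ∑ i, ∑ j, |det3 (x i) (x j) v|) := by
  let n : Fin 3 → ℝ := crossProduct u v
  have hn : n = ![u 1 * v 2 - u 2 * v 1, u 2 * v 0 - u 0 * v 2, u 0 * v 1 - u 1 * v 0] :=
    cross_apply u v
  -- If `u` and `v` are dependent, the left side vanishes.
  rcases eq_or_ne n 0 with h0 | h0
  · have : ∀ y, det3 y u v = 0 := fun y => by
      have e0 := congrFun h0 0
      have e1 := congrFun h0 1
      have e2 := congrFun h0 2
      simp only [hn, Matrix.cons_val, Pi.zero_apply] at e0 e1 e2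
      rw [det3_eq]
      linear_combination y 0 * e0 + y 1 * e1 + y 2 * e2
    simp only [this, abs_zero, Finset.sum_const_zero, mul_zero]
    positivity
  · set D := det3 u v n with hD
    have hD0 : D ≠ 0 := by
      have hD' : D = n 0 ^ 2 + n 1 ^ 2 + n 2 ^ 2 := by
        rw [hD, det3_eq, hn]; simp only [Matrix.cons_val]; ring
      intro h
      apply h0
      rw [hD'] at h
      have e0 : n 0 = 0 := by nlinarith [sq_nonneg (n 0), sq_nonneg (n 1), sq_nonneg (n 2)]
      have e1 : n 1 = 0 := by nlinarith [sq_nonneg (n 0), sq_nonneg (n 1), sq_nonneg (n 2)]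
      have e2 : n 2 = 0 := by nlinarith [sq_nonneg (n 0), sq_nonneg (n 1), sq_nonneg (n 2)]
      ext l; fin_cases l <;> assumption
    let P : Matrix (Fin 3) (Fin 3) ℝ := Matrix.of ![u, v, n]
    let c : ι → Fin 3 → ℝ := fun i => Matrix.vecMul (x i) P⁻¹
    have hx : ∀ i l, x i l = c i 0 * u l + c i 1 * v l + c i 2 * n l := fun i l => by
      have : Matrix.vecMul (c i) P = x i := by
        rw [Matrix.vecMul_vecMul, Matrix.nonsing_inv_mul _ (isUnit_iff_ne_zero.2 hD0),
          Matrix.vecMul_one]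
      rw [← this]
      simp [Matrix.vecMul, dotProduct, Fin.sum_univ_three, P]
    have hD' := hD
    rw [det3_eq] at hD'
    have e1 : ∀ i j k, det3 (x i) (x j) (x k) = det3 (c i) (c j) (c k) * D := fun i j k => by
      rw [hD', det3_eq, det3_eq]; simp only [hx]; ring
    have e2 : ∀ i, det3 (x i) u v = c i 2 * D := fun i => by
      rw [hD', det3_eq]; simp only [hx]; ring
    have e3 : ∀ i j, det3 (x i) (x j) u = (c i 1 * c j 2 - c i 2 * c j 1) * D := fun i j => by
      rw [hD', det3_eq]; simp only [hx]; ring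
    have e4 : ∀ i j, det3 (x i) (x j) v = -(c i 0 * c j 2 - c i 2 * c j 0) * D := fun i j => by
      rw [hD', det3_eq]; simp only [hx]; ring
    simp only [e1, e2, e3, e4, abs_mul, abs_neg, ← Finset.sum_mul]
    -- Each side carries two factors `|D|`.
    nlinarith [mul_le_mul_of_nonneg_right (sum_abs_det3_coord_le c) (mul_self_nonneg |D|)]

/-! ### Multilinear sums of determinants. -/

/-- The sum of the absolute values of the determinants with rows from three families of vectors. -/
def detSum {ι κ μ : Type*} [Fintype ι] [Fintype κ] [Fintype μ]
    (x : ι → Fin 3 → ℝ) (y : κ → Fin 3 → ℝ) (z : μ → Fin 3 → ℝ) : ℝ :=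
  ∑ i, ∑ j, ∑ k, |det3 (x i) (y j) (z k)|

theorem detSum_eq_sum_right {ι κ μ : Type*} [Fintype ι] [Fintype κ] [Fintype μ]
    (x : ι → Fin 3 → ℝ) (y : κ → Fin 3 → ℝ) (z : μ → Fin 3 → ℝ) :
    detSum x y z = ∑ k, ∑ i, ∑ j, |det3 (x i) (y j) (z k)| := by
  rw [Finset.sum_comm]
  exact Finset.sum_congr rfl fun i _ => Finset.sum_comm

theorem detSum_mul_detSum_le {ι κ μ : Type*} [Fintype ι] [Fintype κ] [Fintype μ]
    (x : ι → Fin 3 → ℝ) (y : κ → Fin 3 → ℝ) (z : μ → Fin 3 → ℝ) :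
    detSum x x x * detSum x y z ≤ 3 / 2 * (detSum x x y * detSum x x z) := by
  have e1 : detSum x y z = ∑ j, ∑ k, ∑ i, |det3 (x i) (y j) (z k)| := by
    rw [detSum, Finset.sum_comm]
    exact Finset.sum_congr rfl fun j _ => Finset.sum_comm
  rw [e1, detSum_eq_sum_right x x y, detSum_eq_sum_right x x z, Finset.sum_mul_sum, Finset.mul_sum, Finset.mul_sum]
  refine Finset.sum_le_sum fun j _ => ?_
  rw [Finset.mul_sum, Finset.mul_sum]
  exact Finset.sum_le_sum fun k _ => sum_abs_det3_vec_le x (y j) (z k)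

theorem detSum_swap_left {ι κ μ : Type*} [Fintype ι] [Fintype κ] [Fintype μ]
    (x : ι → Fin 3 → ℝ) (y : κ → Fin 3 → ℝ) (z : μ → Fin 3 → ℝ) :
    detSum y x z = detSum x y z := by
  rw [detSum, detSum, Finset.sum_comm]
  refine Finset.sum_congr rfl fun i _ => Finset.sum_congr rfl fun j _ =>
    Finset.sum_congr rfl fun k _ => ?_
  rw [← abs_neg, det3_eq, det3_eq]
  congr 1; ring

theorem detSum_swap_right {ι κ μ : Type*} [Fintype ι] [Fintype κ] [Fintype μ]
    (x : ι → Fin 3 → ℝ) (y : κ → Fin 3 → ℝ) (z : μ → Fin 3 → ℝ) :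
    detSum x z y = detSum x y z := by
  rw [detSum, detSum]
  refine Finset.sum_congr rfl fun i _ => ?_
  rw [Finset.sum_comm]
  refine Finset.sum_congr rfl fun j _ => Finset.sum_congr rfl fun k _ => ?_
  rw [← abs_neg, det3_eq, det3_eq]
  congr 1; ring

theorem detSum_elim_left {ι ι' κ μ : Type*} [Fintype ι] [Fintype ι'] [Fintype κ] [Fintype μ]
    (x : ι → Fin 3 → ℝ) (x' : ι' → Fin 3 → ℝ) (y : κ → Fin 3 → ℝ) (z : μ → Fin 3 → ℝ) :
    detSum (Sum.elim x x') y z = detSum x y z + detSum x' y z := by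
  simp [detSum, Fintype.sum_sum_type]

theorem detSum_elim_mid {ι κ κ' μ : Type*} [Fintype ι] [Fintype κ] [Fintype κ'] [Fintype μ]
    (x : ι → Fin 3 → ℝ) (y : κ → Fin 3 → ℝ) (y' : κ' → Fin 3 → ℝ) (z : μ → Fin 3 → ℝ) :
    detSum x (Sum.elim y y') z = detSum x y z + detSum x y' z := by
  simp [detSum, Fintype.sum_sum_type, Finset.sum_add_distrib]

theorem detSum_elim_right {ι κ μ μ' : Type*} [Fintype ι] [Fintype κ] [Fintype μ] [Fintype μ']
    (x : ι → Fin 3 → ℝ) (y : κ → Fin 3 → ℝ) (z : μ → Fin 3 → ℝ) (z' : μ' → Fin 3 → ℝ) :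
    detSum x y (Sum.elim z z') = detSum x y z + detSum x y z' := by
  simp [detSum, Fintype.sum_sum_type, Finset.sum_add_distrib]

theorem detSum_nonneg {ι κ μ : Type*} [Fintype ι] [Fintype κ] [Fintype μ]
    (x : ι → Fin 3 → ℝ) (y : κ → Fin 3 → ℝ) (z : μ → Fin 3 → ℝ) : 0 ≤ detSum x y z :=
  Finset.sum_nonneg fun _ _ => Finset.sum_nonneg fun _ _ => Finset.sum_nonneg fun _ _ =>
    abs_nonneg _

theorem detSum_smul_left {ι κ μ : Type*} [Fintype ι] [Fintype κ] [Fintype μ] {t : ℝ} (ht : 0 ≤ t)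
    (x : ι → Fin 3 → ℝ) (y : κ → Fin 3 → ℝ) (z : μ → Fin 3 → ℝ) :
    detSum (t • x) y z = t * detSum x y z := by
  simp only [detSum, Finset.mul_sum]
  refine Finset.sum_congr rfl fun i _ => Finset.sum_congr rfl fun j _ =>
    Finset.sum_congr rfl fun k _ => ?_
  rw [← abs_of_nonneg ht, ← abs_mul, abs_of_nonneg ht, det3_eq, det3_eq]
  simp only [Pi.smul_apply, smul_eq_mul]
  congr 1; ring

theorem detSum_smul_mid {ι κ μ : Type*} [Fintype ι] [Fintype κ] [Fintype μ] {t : ℝ} (ht : 0 ≤ t)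
    (x : ι → Fin 3 → ℝ) (y : κ → Fin 3 → ℝ) (z : μ → Fin 3 → ℝ) :
    detSum x (t • y) z = t * detSum x y z := by
  rw [detSum_swap_left, detSum_smul_left ht, detSum_swap_left]

theorem detSum_smul_right {ι κ μ : Type*} [Fintype ι] [Fintype κ] [Fintype μ] {t : ℝ} (ht : 0 ≤ t)
    (x : ι → Fin 3 → ℝ) (y : κ → Fin 3 → ℝ) (z : μ → Fin 3 → ℝ) :
    detSum x y (t • z) = t * detSum x y z := by
  rw [detSum_swap_right, detSum_smul_mid ht, detSum_swap_right]

/-! ### Volumes of zonotopes. -/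

theorem volume_eq_lintegral_cons {n : ℕ} {S : Set (Fin (n + 1) → ℝ)} (hS : MeasurableSet S) :
    volume S = ∫⁻ y : Fin n → ℝ, volume {t : ℝ | (Fin.cons t y : Fin (n + 1) → ℝ) ∈ S} := by
  have h := (volume_preserving_piFinSuccAbove (fun _ : Fin (n + 1) => ℝ) 0).symm
  rw [← h.measure_preimage hS.nullMeasurableSet, Measure.volume_eq_prod,
    Measure.prod_apply_symm (h.measurable hS)]
  refine lintegral_congr fun y => ?_
  congr 1
  ext t
  simp [MeasurableEquiv.piFinSuccAbove, Fin.insertNthEquiv]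

/-- Adding a unit segment in the first coordinate direction to a compact convex set increases its
volume by the volume of the projection along that direction. -/
theorem volume_add_segment_single {n : ℕ} {K : Set (Fin (n + 1) → ℝ)} (hK : IsCompact K)
    (hc : Convex ℝ K) :
    volume (K + segment ℝ 0 (Pi.single 0 1 : Fin (n + 1) → ℝ)) =
      volume K + volume ((Fin.tail : (Fin (n + 1) → ℝ) → Fin n → ℝ) '' K) := by
  have hseg : IsCompact (segment ℝ 0 (Pi.single 0 1 : Fin (n + 1) → ℝ)) := by
    rw [segment_eq_image]
    exact isCompact_Icc.image (by fun_prop)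
  have htail : Continuous (Fin.tail : (Fin (n + 1) → ℝ) → Fin n → ℝ) :=
    continuous_pi fun i => continuous_apply i.succ
  have hT : MeasurableSet ((Fin.tail : (Fin (n + 1) → ℝ) → Fin n → ℝ) '' K) :=
    (hK.image htail).measurableSet
  rw [volume_eq_lintegral_cons (hK.add hseg).measurableSet,
    volume_eq_lintegral_cons hK.measurableSet, ← lintegral_indicator_one hT,
    ← lintegral_add_right _ (measurable_one.indicator hT)]
  refine lintegral_congr fun y => ?_
  set F : Set ℝ := {t : ℝ | (Fin.cons t y : Fin (n + 1) → ℝ) ∈ K} with hF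
  have hadd : {t : ℝ | (Fin.cons t y : Fin (n + 1) → ℝ) ∈
      K + segment ℝ 0 (Pi.single 0 1 : Fin (n + 1) → ℝ)} = F + Set.Icc 0 1 := by
    ext t
    simp only [segment_eq_image, Set.mem_ofPred_eq, Set.mem_add, Set.mem_image, smul_zero, zero_add]
    constructor
    · rintro ⟨x, hx, _, ⟨r, hr, rfl⟩, h⟩
      refine ⟨x 0, ?_, r, hr, ?_⟩
      · rw [hF, Set.mem_ofPred_eq]
        convert hx
        have : y = Fin.tail x := by
          ext i
          have := congrFun h i.succ
          simpa [Fin.tail] using this.symm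
        rw [this, Fin.cons_self_tail]
      · simpa using congrFun h 0
    · rintro ⟨s, hs, r, hr, rfl⟩
      refine ⟨_, hs, _, ⟨r, hr, rfl⟩, ?_⟩
      ext i
      refine Fin.cases ?_ (fun j => ?_) i <;> simp
  rw [hadd]
  by_cases hy : y ∈ (Fin.tail : (Fin (n + 1) → ℝ) → Fin n → ℝ) '' K
  -- Over the projection of `K` the fibre is a nonempty compact interval, which the segment
  -- lengthens by one.
  · have hFc : IsCompact F := by
      have : F = (fun x : Fin (n + 1) → ℝ => x 0) '' (K ∩ Fin.tail ⁻¹' {y}) := by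
        ext t
        simp only [hF, Set.mem_ofPred_eq, Set.mem_image, Set.mem_inter_iff, Set.mem_preimage,
          Set.mem_singleton_iff]
        constructor
        · intro h
          exact ⟨_, ⟨h, Fin.tail_cons _ _⟩, Fin.cons_zero _ _⟩
        · rintro ⟨x, ⟨hx, rfl⟩, rfl⟩
          rwa [Fin.cons_self_tail]
      rw [this]
      exact (hK.inter_right (isClosed_singleton.preimage htail)).image (continuous_apply 0)
    have hFconv : Convex ℝ F := by
      intro s hs t ht α β hα hβ hαβ
      have := hc hs ht hα hβ hαβ
      rw [hF, Set.mem_ofPred_eq]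
      convert this using 1
      ext i
      refine Fin.cases ?_ (fun j => ?_) i
      · simp
      · simp [← add_mul, hαβ]
    have hFne : F.Nonempty := by
      obtain ⟨x, hx, rfl⟩ := hy
      exact ⟨x 0, by rwa [hF, Set.mem_ofPred_eq, Fin.cons_self_tail]⟩
    obtain ⟨a, b, hab, hFab⟩ : ∃ a b, a ≤ b ∧ F = Set.Icc a b := by
      have h := eq_Icc_of_connected_compact ⟨hFne, hFconv.isPreconnected⟩ hFc
      refine ⟨_, _, ?_, h⟩
      rw [h] at hFne
      exact Set.nonempty_Icc.1 hFne
    have hsum : Set.Icc a b + Set.Icc (0 : ℝ) 1 = Set.Icc a (b + 1) := by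
      ext t
      simp only [Set.mem_add, Set.mem_Icc]
      constructor
      · rintro ⟨s, hs, r, hr, rfl⟩
        constructor <;> linarith
      · intro ht
        refine ⟨min t b, ⟨le_min ht.1 hab, min_le_right _ _⟩, t - min t b, ⟨?_, ?_⟩, by ring⟩
        · linarith [min_le_left t b]
        · rcases min_choice t b with h | h <;> rw [h] <;> linarith
    rw [Set.indicator_of_mem hy, hFab, hsum, Real.volume_Icc, Real.volume_Icc, Pi.one_apply,
      ← ENNReal.ofReal_one, ← ENNReal.ofReal_add (by linarith) zero_le_one]
    congr 1; ring
  · have hFe : F = ∅ := by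
      refine Set.eq_empty_of_forall_notMem fun t ht => hy ⟨_, ht, Fin.tail_cons _ _⟩
    rw [Set.indicator_of_notMem hy, hFe]
    simp

/-- The zonotope spanned by a finite family of vectors. -/
def zonotope {ι E : Type*} [AddCommGroup E] [Module ℝ E] (s : Finset ι) (x : ι → E) : Set E :=
  ∑ i ∈ s, segment ℝ 0 (x i)

section Zonotope

variable {ι E : Type*} [AddCommGroup E] [Module ℝ E]

theorem convex_zonotope (s : Finset ι) (x : ι → E) : Convex ℝ (zonotope s x) :=
  convex_sum _ fun _ _ => convex_segment _ _

theorem isCompact_zonotope [TopologicalSpace E] [ContinuousAdd E] [ContinuousSMul ℝ E]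
    (s : Finset ι) (x : ι → E) : IsCompact (zonotope s x) := by
  refine Finset.sum_induction _ IsCompact (fun a b => IsCompact.add) isCompact_singleton
    fun i _ => ?_
  rw [segment_eq_image]
  exact isCompact_Icc.image (by fun_prop)

theorem image_zonotope {F : Type*} [AddCommGroup F] [Module ℝ F] (g : E →ₗ[ℝ] F) (s : Finset ι)
    (x : ι → E) : g '' zonotope s x = zonotope s fun i => g (x i) := by
  rw [zonotope, Set.image_finsetSum]
  refine Finset.sum_congr rfl fun i _ => ?_
  simpa using image_segment ℝ g.toAffineMap 0 (x i)

theorem zero_mem_zonotope (s : Finset ι) (x : ι → E) : (0 : E) ∈ zonotope s x :=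
  Finset.sum_induction _ (fun S : Set E => (0 : E) ∈ S)
    (fun _ _ ha hb => ⟨0, ha, 0, hb, add_zero 0⟩) rfl fun _ _ => left_mem_segment _ _ _

theorem zonotope_insert [DecidableEq ι] {s : Finset ι} {a : ι} (ha : a ∉ s) (x : ι → E) :
    zonotope (insert a s) x = zonotope s x + segment ℝ 0 (x a) := by
  rw [zonotope, Finset.sum_insert ha, add_comm, zonotope]

end Zonotope

/-- The projection of `ℝⁿ⁺¹` that forgets the first coordinate. -/
def tailLinear (n : ℕ) : (Fin (n + 1) → ℝ) →ₗ[ℝ] (Fin n → ℝ) where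
  toFun := Fin.tail
  map_add' _ _ := rfl
  map_smul' _ _ := rfl

theorem tailLinear_apply {n : ℕ} (x : Fin (n + 1) → ℝ) (i : Fin n) :
    tailLinear n x i = x i.succ := rfl

/-- A linear isomorphism sends the new generator to the first basis vector, where the volume gained
is that of the projection; `|det g|` undoes the scaling. -/
theorem volume_zonotope_insert {ι : Type*} [DecidableEq ι] {n : ℕ} {s : Finset ι} {a : ι}
    (ha : a ∉ s) (x : ι → Fin (n + 1) → ℝ) (hx : x a ≠ 0) :
    ∃ g : (Fin (n + 1) → ℝ) →ₗ[ℝ] (Fin (n + 1) → ℝ), g (x a) = Pi.single 0 1 ∧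
      LinearMap.det g ≠ 0 ∧
      volume.real (zonotope (insert a s) x) = volume.real (zonotope s x) +
        |LinearMap.det g|⁻¹ * volume.real (zonotope s fun i => tailLinear n (g (x i))) := by
  obtain ⟨g, hg⟩ := SeparatingDual.exists_continuousLinearEquiv_apply_eq (R := ℝ) hx
    (y := (Pi.single 0 1 : Fin (n + 1) → ℝ)) (by simp)
  let G : (Fin (n + 1) → ℝ) →ₗ[ℝ] (Fin (n + 1) → ℝ) := g.toLinearEquiv
  have hdet : LinearMap.det G ≠ 0 := g.toLinearEquiv.isUnit_det'.ne_zero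
  refine ⟨G, hg, hdet, ?_⟩
  have hGx : G (x a) = Pi.single 0 1 := hg
  have scale : ∀ S : Set (Fin (n + 1) → ℝ),
      volume.real (G '' S) = |LinearMap.det G| * volume.real S := fun S => by
    rw [measureReal_def, Measure.addHaar_image_linearMap, ENNReal.toReal_mul,
      ENNReal.toReal_ofReal (abs_nonneg _), measureReal_def]
  have h0 : |LinearMap.det G| ≠ 0 := abs_ne_zero.2 hdet
  have h1 := scale (zonotope (insert a s) x)
  have h2 := scale (zonotope s x)
  rw [image_zonotope, zonotope_insert ha, hGx, measureReal_def,
    volume_add_segment_single (isCompact_zonotope _ _) (convex_zonotope _ _),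
    ENNReal.toReal_add (isCompact_zonotope _ _).measure_ne_top ?_, ← measureReal_def,
    ← image_zonotope, h2] at h1
  · change _ + (volume (tailLinear n '' _)).toReal = _ at h1
    rw [← image_zonotope (tailLinear n) s fun i => G (x i), ← image_zonotope G]
    simp only [measureReal_def] at h1 ⊢
    field_simp
    linarith
  · change volume (tailLinear n '' _) ≠ ⊤
    rw [image_zonotope]
    exact (isCompact_zonotope _ _).measure_ne_top

theorem det_mul_det_eq {n : ℕ} (g : (Fin n → ℝ) →ₗ[ℝ] (Fin n → ℝ)) (v : Fin n → Fin n → ℝ) :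
    LinearMap.det g * (Matrix.of v).det = (Matrix.of fun i => g (v i)).det := by
  have h := (Pi.basisFun ℝ (Fin n)).det_comp g v
  rw [Pi.basisFun_det] at h
  exact h.symm

/-- The determinant of two vectors in the plane. -/
def det2 (x y : Fin 2 → ℝ) : ℝ := x 0 * y 1 - y 0 * x 1

/-- After applying `g` the first row is a basis vector, leaving a single minor. -/
theorem det_mul_det3_of_apply_eq {g : (Fin 3 → ℝ) →ₗ[ℝ] (Fin 3 → ℝ)} {x : Fin 3 → ℝ}
    (hx : g x = Pi.single 0 1) (y z : Fin 3 → ℝ) :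
    LinearMap.det g * det3 x y z = det2 (tailLinear 2 (g y)) (tailLinear 2 (g z)) := by
  have h := det_mul_det_eq g ![x, y, z]
  rw [Matrix.det_fin_three (Matrix.of fun i => g (![x, y, z] i))] at h
  simp only [Matrix.of_apply, Matrix.cons_val, hx] at h
  rw [det3, h]
  simp [det2, tailLinear_apply]
  ring

theorem det_mul_det2_of_apply_eq {g : (Fin 2 → ℝ) →ₗ[ℝ] (Fin 2 → ℝ)} {x : Fin 2 → ℝ}
    (hx : g x = Pi.single 0 1) (y : Fin 2 → ℝ) :
    LinearMap.det g * det2 x y = tailLinear 1 (g y) 0 := by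
  have h := det_mul_det_eq g ![x, y]
  rw [Matrix.det_fin_two (Matrix.of ![x, y]),
    Matrix.det_fin_two (Matrix.of fun i => g (![x, y] i))] at h
  simp [hx] at h
  rw [det2, mul_comm (y 0), h]
  simp [tailLinear_apply]

theorem det_mul_of_apply_eq {g : (Fin 1 → ℝ) →ₗ[ℝ] (Fin 1 → ℝ)} {x : Fin 1 → ℝ}
    (hx : g x = Pi.single 0 1) : LinearMap.det g * x 0 = 1 := by
  have h := det_mul_det_eq g ![x]
  simpa [Matrix.det_fin_one, hx] using h

section Volume

variable {ι : Type*}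

theorem zonotope_insert_of_eq_zero {E : Type*} [AddCommGroup E] [Module ℝ E] [DecidableEq ι]
    {s : Finset ι} {a : ι} (ha : a ∉ s) {x : ι → E} (hx : x a = 0) :
    zonotope (insert a s) x = zonotope s x := by
  rw [zonotope_insert ha, hx, segment_same, Set.singleton_zero, add_zero]

theorem volume_zonotope_fin_one (s : Finset ι) (x : ι → Fin 1 → ℝ) :
    volume.real (zonotope s x) = ∑ i ∈ s, |x i 0| := by
  classical
  induction s using Finset.induction_on with
  | empty => simp [zonotope, measureReal_def, ← Set.singleton_zero]
  | insert a s ha ih =>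
    rw [Finset.sum_insert ha]
    by_cases hx : x a = 0
    · simp [zonotope_insert_of_eq_zero ha hx, hx, ih]
    · obtain ⟨g, hg, hdet, h⟩ := volume_zonotope_insert ha x hx
      -- The projection lands in dimension zero, where the only point has volume one.
      have h1 : volume.real (zonotope s fun i => tailLinear 0 (g (x i))) = 1 := by
        have : zonotope s (fun i => tailLinear 0 (g (x i))) = Set.univ := by
          refine Set.eq_univ_of_forall fun y => ?_
          rw [Subsingleton.elim y 0]
          exact zero_mem_zonotope _ _
        rw [this, measureReal_def, volume_pi, Measure.pi_of_empty]
        simp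
      rw [h, h1, ih, add_comm, mul_one]
      congr 1
      have := det_mul_of_apply_eq hg
      rw [eq_comm, ← one_div, eq_div_iff (abs_ne_zero.2 hdet), ← abs_mul, mul_comm, this, abs_one]

theorem volume_zonotope_fin_two (s : Finset ι) (x : ι → Fin 2 → ℝ) :
    volume.real (zonotope s x) = 1 / 2 * ∑ i ∈ s, ∑ j ∈ s, |det2 (x i) (x j)| := by
  classical
  induction s using Finset.induction_on with
  | empty => simp [zonotope, measureReal_def, ← Set.singleton_zero]
  | insert a s ha ih =>
    have e0 : |det2 (x a) (x a)| = 0 := by rw [det2, sub_self, abs_zero]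
    have e1 : ∀ i, |det2 (x i) (x a)| = |det2 (x a) (x i)| := fun i => by
      rw [← abs_neg, det2, det2]; congr 1; ring
    simp only [Finset.sum_insert ha, Finset.sum_add_distrib, e0, e1]
    by_cases hx : x a = 0
    · have : ∀ i, det2 (x a) (x i) = 0 := fun i => by simp [det2, hx]
      simp [zonotope_insert_of_eq_zero ha hx, this, ih]
    · obtain ⟨g, hg, hdet, h⟩ := volume_zonotope_insert ha x hx
      have h0 := abs_ne_zero.2 hdet
      rw [h, volume_zonotope_fin_one, ih]
      simp only [← det_mul_det2_of_apply_eq hg, abs_mul, ← Finset.mul_sum]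
      field_simp
      ring

/-- Induction on the generators: the new one occupies any of three positions, and `3 · 1/6` is the
`1/2` of the planar formula for the projection. -/
theorem volume_zonotope_fin_three (s : Finset ι) (x : ι → Fin 3 → ℝ) :
    volume.real (zonotope s x) =
      1 / 6 * ∑ i ∈ s, ∑ j ∈ s, ∑ k ∈ s, |det3 (x i) (x j) (x k)| := by
  classical
  induction s using Finset.induction_on with
  | empty => simp [zonotope, measureReal_def, ← Set.singleton_zero]
  | insert a s ha ih =>
    have e0 : ∀ i, |det3 (x a) (x a) (x i)| = 0 := fun i => by
      rw [det3_eq, abs_eq_zero]; ring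
    have e0' : ∀ i, |det3 (x a) (x i) (x a)| = 0 := fun i => by
      rw [det3_eq, abs_eq_zero]; ring
    have e1 : ∀ i j, |det3 (x i) (x a) (x j)| = |det3 (x a) (x i) (x j)| := fun i j => by
      rw [← abs_neg, det3_eq, det3_eq]; congr 1; ring
    have e2 : ∀ i j, |det3 (x i) (x j) (x a)| = |det3 (x a) (x i) (x j)| := fun i j => by
      rw [det3_eq, det3_eq]; congr 1; ring
    simp only [Finset.sum_insert ha, Finset.sum_add_distrib, e0, e0', e1, e2,
      Finset.sum_const_zero]
    by_cases hx : x a = 0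
    · have : ∀ i j, det3 (x a) (x i) (x j) = 0 := fun i j => by simp [det3_eq, hx]
      simp [zonotope_insert_of_eq_zero ha hx, this, ih]
    · obtain ⟨g, hg, hdet, h⟩ := volume_zonotope_insert ha x hx
      have h0 := abs_ne_zero.2 hdet
      rw [h, volume_zonotope_fin_two, ih]
      simp only [← det_mul_det3_of_apply_eq hg, abs_mul, ← Finset.mul_sum]
      field_simp
      ring

end Volume

/-! ### Mixed volumes of zonotopes. -/

/-- The translate by `p` of the zonotope in Euclidean space spanned by the vectors `x i`. -/
def zonotopeAt {ι : Type*} [Fintype ι] (p : E3) (x : ι → Fin 3 → ℝ) : Set E3 :=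
  {p} + zonotope Finset.univ fun i => WithLp.toLp 2 (x i)

theorem isCompact_zonotopeAt {ι : Type*} [Fintype ι] (p : E3) (x : ι → Fin 3 → ℝ) :
    IsCompact (zonotopeAt p x) :=
  isCompact_singleton.add (isCompact_zonotope _ _)

theorem zonotopeAt_add {ι κ : Type*} [Fintype ι] [Fintype κ] (p q : E3) (x : ι → Fin 3 → ℝ)
    (y : κ → Fin 3 → ℝ) :
    zonotopeAt p x + zonotopeAt q y = zonotopeAt (p + q) (Sum.elim x y) := by
  rw [zonotopeAt, zonotopeAt, add_add_add_comm, Set.singleton_add_singleton, zonotopeAt]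
  congr 1
  simp [zonotope, Fintype.sum_sum_type]

theorem volume_zonotopeAt {ι : Type*} [Fintype ι] (p : E3) (x : ι → Fin 3 → ℝ) :
    (volume : Measure E3).real (zonotopeAt p x) = detSum x x x / 6 := by
  have himage : (WithLp.linearEquiv 2 ℝ (Fin 3 → ℝ)).symm.toLinearMap '' zonotope Finset.univ x
      = zonotope Finset.univ fun i => WithLp.toLp 2 (x i) := by
    rw [image_zonotope]; rfl
  have hpre : (zonotope Finset.univ fun i => (WithLp.toLp 2 (x i) : E3))
      = WithLp.ofLp ⁻¹' zonotope Finset.univ x := by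
    rw [← himage]
    ext v
    constructor
    · rintro ⟨w, hw, rfl⟩
      exact hw
    · intro hv
      exact ⟨_, hv, rfl⟩
  rw [zonotopeAt, Set.singleton_add, Set.image_add_left, measureReal_def, measure_preimage_add,
    hpre, (PiLp.volume_preserving_ofLp (Fin 3)).measure_preimage
      (isCompact_zonotope _ _).measurableSet.nullMeasurableSet, ← measureReal_def,
    volume_zonotope_fin_three]
  simp only [detSum]
  ring

theorem IsZonotope.exists_eq_zonotopeAt {K : ConvexBody E3} (h : IsZonotope K) :
    ∃ (m : ℕ) (p : E3) (x : Fin m → Fin 3 → ℝ), (K : Set E3) = zonotopeAt p x := by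
  obtain ⟨m, a, b, h⟩ := h
  refine ⟨m, ∑ i, a i, fun i => (b i - a i).ofLp, ?_⟩
  have hs : ({∑ i, a i} : Set E3) = ∑ i, {a i} :=
    map_sum (Set.singletonAddMonoidHom (α := E3)) a Finset.univ
  rw [h, zonotopeAt, zonotope, hs, ← Finset.sum_add_distrib]
  refine Finset.sum_congr rfl fun i _ => ?_
  have := segment_translate_image ℝ (a i) 0 (b i - a i)
  rw [Set.singleton_add, this, add_zero, add_sub_cancel]

/-- Minkowski sums concatenate generators, so `detSum` expands trilinearly; polarization keeps the
six orderings of `x`, `y`, `z`, which agree. -/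
theorem mixedVolume_of_eq_zonotopeAt {ι κ μ : Type*} [Fintype ι] [Fintype κ] [Fintype μ]
    {A B C : ConvexBody E3} {p q r : E3} {x : ι → Fin 3 → ℝ} {y : κ → Fin 3 → ℝ}
    {z : μ → Fin 3 → ℝ} (hA : (A : Set E3) = zonotopeAt p x) (hB : (B : Set E3) = zonotopeAt q y)
    (hC : (C : Set E3) = zonotopeAt r z) : mixedVolume A B C = detSum x y z / 6 := by
  simp only [mixedVolume, bodyVol, ConvexBody.coe_add, hA, hB, hC, zonotopeAt_add,
    volume_zonotopeAt, detSum_elim_left, detSum_elim_mid, detSum_elim_right]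
  linarith [detSum_swap_left x y x, detSum_swap_right x x y, detSum_swap_left x y y,
    detSum_swap_right y x y, detSum_swap_left x z x, detSum_swap_right x x z,
    detSum_swap_left x z z, detSum_swap_right z x z, detSum_swap_left y z y,
    detSum_swap_right y y z, detSum_swap_left y z z, detSum_swap_right z y z,
    detSum_swap_right x y z, detSum_swap_left x y z, detSum_swap_left x z y,
    detSum_swap_right y x z, detSum_swap_right z x y]

theorem mixedVolume_mul_le_of_isZonotope {A B C : ConvexBody E3} (hA : IsZonotope A)
    (hB : IsZonotope B) (hC : IsZonotope C) :
    mixedVolume A A A * mixedVolume A B C ≤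
      (3 / 2 : ℝ) * (mixedVolume A A B * mixedVolume A A C) := by
  obtain ⟨_, _, x, hA⟩ := hA.exists_eq_zonotopeAt
  obtain ⟨_, _, y, hB⟩ := hB.exists_eq_zonotopeAt
  obtain ⟨_, _, z, hC⟩ := hC.exists_eq_zonotopeAt
  rw [mixedVolume_of_eq_zonotopeAt hA hA hA, mixedVolume_of_eq_zonotopeAt hA hB hC,
    mixedVolume_of_eq_zonotopeAt hA hA hB, mixedVolume_of_eq_zonotopeAt hA hA hC]
  linarith [detSum_mul_detSum_le x y z]

/-! ### Continuity of volume and passage to zonoids. -/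

section Continuity

theorem ConvexBody.exists_dist_le {V : Type*} [NormedAddCommGroup V] [NormedSpace ℝ V]
    (K L : ConvexBody V) {x : V} (hx : x ∈ (K : Set V)) :
    ∃ y ∈ (L : Set V), dist x y ≤ dist K L := by
  obtain ⟨y, hy, h⟩ := L.isCompact.exists_infDist_eq_dist L.nonempty x
  refine ⟨y, hy, ?_⟩
  rw [← h]
  exact Metric.infDist_le_hausdorffDist_of_mem hx ConvexBody.hausdorffEDist_ne_top

theorem ConvexBody.subset_add_closedBall {V : Type*} [NormedAddCommGroup V] [NormedSpace ℝ V]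
    (K L : ConvexBody V) : (K : Set V) ⊆ (L : Set V) + Metric.closedBall 0 (dist K L) := fun x hx => by
  obtain ⟨y, hy, h⟩ := K.exists_dist_le L hx
  exact ⟨y, hy, x - y, by simpa [dist_eq_norm] using h, add_sub_cancel y x⟩

theorem ConvexBody.dist_add_le {V : Type*} [NormedAddCommGroup V] [NormedSpace ℝ V]
    (K L K' L' : ConvexBody V) : dist (K + L) (K' + L') ≤ dist K K' + dist L L' := by
  refine Metric.hausdorffDist_le_of_mem_dist (add_nonneg dist_nonneg dist_nonneg) ?_ ?_
  · rintro _ ⟨x, hx, y, hy, rfl⟩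
    obtain ⟨x', hx', h⟩ := K.exists_dist_le K' hx
    obtain ⟨y', hy', h'⟩ := L.exists_dist_le L' hy
    exact ⟨_, ⟨x', hx', y', hy', rfl⟩, (dist_add_add_le _ _ _ _).trans (add_le_add h h')⟩
  · rintro _ ⟨x, hx, y, hy, rfl⟩
    obtain ⟨x', hx', h⟩ := K'.exists_dist_le K hx
    obtain ⟨y', hy', h'⟩ := L'.exists_dist_le L hy
    rw [dist_comm K, dist_comm L]
    exact ⟨_, ⟨x', hx', y', hy', rfl⟩, (dist_add_add_le _ _ _ _).trans (add_le_add h h')⟩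

theorem ConvexBody.tendsto_add {V α : Type*} [NormedAddCommGroup V] [NormedSpace ℝ V]
    {l : Filter α} {f g : α → ConvexBody V} {K L : ConvexBody V} (hf : Tendsto f l (𝓝 K))
    (hg : Tendsto g l (𝓝 L)) : Tendsto (fun n => f n + g n) l (𝓝 (K + L)) := by
  rw [tendsto_iff_dist_tendsto_zero] at hf hg ⊢
  refine squeeze_zero (fun _ => dist_nonneg) (fun n => ConvexBody.dist_add_le _ _ _ _) ?_
  simpa using hf.add hg

/-- The standard basis of `ℝ³` as a family of generators of a cube. -/
def cubeGen : Fin 3 → Fin 3 → ℝ := fun l => Pi.single l 1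

theorem closedBall_subset_zonotopeAt {ε : ℝ} (hε : 0 ≤ ε) :
    Metric.closedBall (0 : E3) ε ⊆
      zonotopeAt (WithLp.toLp 2 fun _ => -ε) ((2 * ε) • cubeGen) := by
  intro y hy
  rw [mem_closedBall_zero_iff] at hy
  have hy' : ∀ l, |y l| ≤ ε := fun l => (PiLp.norm_apply_le y l).trans hy
  refine ⟨_, rfl, y - WithLp.toLp 2 fun _ => -ε, ?_, add_sub_cancel _ _⟩
  have : y - (WithLp.toLp 2 fun _ => -ε) =
      ∑ l, (WithLp.toLp 2 ((y l + ε) • cubeGen l) : E3) := by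
    ext l
    simp [cubeGen, Pi.single_apply]
  rw [this]
  refine Set.finsetSum_mem_finsetSum _ _ _ fun l _ => ?_
  obtain ⟨h1, h2⟩ := abs_le.1 (hy' l)
  rw [segment_eq_image]
  -- The segment parameter divides by `2 * ε`, so radius zero is treated apart.
  rcases hε.eq_or_lt with rfl | hε
  · refine ⟨0, by simp, ?_⟩
    have : y l = 0 := le_antisymm h2 (by linarith)
    simp [this]
  · refine ⟨(y l + ε) / (2 * ε), ⟨div_nonneg (by linarith) (by linarith),
      (div_le_one (by linarith)).2 (by linarith)⟩, ?_⟩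
    beta_reduce
    rw [smul_zero, zero_add, Pi.smul_apply, ← WithLp.toLp_smul, smul_smul,
      div_mul_cancel₀ _ (by positivity)]

/-- The expansion is a cubic in `t` with nonnegative coefficients, and `t ^ 2`, `t ^ 3` are at most
`t` here. -/
theorem detSum_elim_smul_le {ι κ : Type*} [Fintype ι] [Fintype κ] (x : ι → Fin 3 → ℝ)
    (y : κ → Fin 3 → ℝ) {t : ℝ} (h0 : 0 ≤ t) (h1 : t ≤ 1) :
    detSum (Sum.elim x (t • y)) (Sum.elim x (t • y)) (Sum.elim x (t • y)) ≤
      detSum x x x + t * detSum (Sum.elim x y) (Sum.elim x y) (Sum.elim x y) := by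
  simp only [detSum_elim_left, detSum_elim_mid, detSum_elim_right, detSum_smul_left h0,
    detSum_smul_mid h0, detSum_smul_right h0]
  have h2 : ∀ c : ℝ, 0 ≤ c → t * (t * c) ≤ t * c := fun c hc =>
    mul_le_of_le_one_left (mul_nonneg h0 hc) h1
  have h3 : ∀ c : ℝ, 0 ≤ c → t * (t * (t * c)) ≤ t * c := fun c hc =>
    (h2 _ (mul_nonneg h0 hc)).trans (h2 c hc)
  linarith [h2 _ (detSum_nonneg x y y), h2 _ (detSum_nonneg y x y), h2 _ (detSum_nonneg y y x),
    h3 _ (detSum_nonneg y y y), mul_nonneg h0 (detSum_nonneg x x x)]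

/-- From above, `Z n` lies in a thickening of `K`. From below, `K` lies in `Z n` plus a small cube,
again a zonotope, so the determinant formula bounds the excess volume linearly in the distance. -/
theorem tendsto_bodyVol {Z : ℕ → ConvexBody E3} {K : ConvexBody E3} (hZ : ∀ n, IsZonotope (Z n))
    (hK : Tendsto Z atTop (𝓝 K)) : Tendsto (fun n => bodyVol (Z n)) atTop (𝓝 (bodyVol K)) := by
  have hd : Tendsto (fun n => dist (Z n) K) atTop (𝓝 0) := tendsto_iff_dist_tendsto_zero.1 hK
  have hcomp : ∀ r, IsCompact ((K : Set E3) + Metric.closedBall 0 r) := fun r =>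
    K.isCompact.add (isCompact_closedBall 0 r)
  -- A fixed compact set that eventually contains `Z n` plus a unit cube, making the linear bound
  -- uniform in `n`.
  let S : Set E3 := ((K : Set E3) + Metric.closedBall 0 1) + zonotopeAt 0 cubeGen
  have hS : IsCompact S := (hcomp 1).add (isCompact_zonotopeAt _ _)
  have lower : ∀ᶠ n in atTop,
      bodyVol K - 2 * dist (Z n) K * volume.real S ≤ bodyVol (Z n) := by
    -- The cube has side `2 * dist (Z n) K`, which must be at most one.
    filter_upwards [hd.eventually_le_const (show (0 : ℝ) < 1 / 2 by norm_num)] with n hn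
    obtain ⟨m, p, x, hx⟩ := (hZ n).exists_eq_zonotopeAt
    have hsub : (K : Set E3) ⊆ zonotopeAt (p + WithLp.toLp 2 fun _ => -dist (Z n) K)
        (Sum.elim x ((2 * dist (Z n) K) • cubeGen)) := by
      refine (K.subset_add_closedBall (Z n)).trans ?_
      rw [dist_comm K]
      refine (Set.add_subset_add_left (closedBall_subset_zonotopeAt dist_nonneg)).trans ?_
      rw [hx, zonotopeAt_add]
    have h1 := measureReal_mono (μ := volume) hsub (isCompact_zonotopeAt _ _).measure_ne_top
    have hsub' : zonotopeAt (p + 0) (Sum.elim x cubeGen) ⊆ S := by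
      rw [← zonotopeAt_add, ← hx]
      refine Set.add_subset_add_right (((Z n).subset_add_closedBall K).trans ?_)
      exact Set.add_subset_add_left (Metric.closedBall_subset_closedBall (by linarith))
    have h2 := measureReal_mono (μ := volume) hsub' hS.measure_ne_top
    rw [volume_zonotopeAt] at h1 h2
    have h3 := detSum_elim_smul_le x cubeGen (t := 2 * dist (Z n) K)
      (mul_nonneg zero_le_two dist_nonneg) (by linarith)
    have h4 : bodyVol (Z n) = detSum x x x / 6 := by rw [bodyVol, hx, volume_zonotopeAt]
    have h5 := mul_le_mul_of_nonneg_left h2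
      (mul_nonneg zero_le_two (dist_nonneg (x := Z n) (y := K)))
    rw [h4, bodyVol]
    linarith
  have upper : ∀ n, bodyVol (Z n) ≤ volume.real (Metric.cthickening (dist (Z n) K) (K : Set E3)) :=
    fun n => by
      rw [← K.isCompact.add_closedBall_zero dist_nonneg]
      exact measureReal_mono ((Z n).subset_add_closedBall K) (hcomp _).measure_ne_top
  refine tendsto_of_tendsto_of_tendsto_of_le_of_le' ?_ ?_ lower (Eventually.of_forall upper)
  · have := (hd.const_mul 2).mul_const (volume.real S)
    simpa using this.const_sub (bodyVol K)
  · exact (ENNReal.tendsto_toReal K.isCompact.measure_ne_top).comp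
      ((tendsto_measure_cthickening_of_isCompact K.isCompact).comp hd)

end Continuity

theorem IsZonotope.add {K L : ConvexBody E3} (hK : IsZonotope K) (hL : IsZonotope L) :
    IsZonotope (K + L) := by
  obtain ⟨m, a, b, h⟩ := hK
  obtain ⟨m', a', b', h'⟩ := hL
  refine ⟨m + m', Fin.append a a', Fin.append b b', ?_⟩
  rw [ConvexBody.coe_add, h, h', Fin.sum_univ_add]
  simp

theorem tendsto_mixedVolume {X Y Z : ℕ → ConvexBody E3} {A B C : ConvexBody E3}
    (hX : ∀ n, IsZonotope (X n)) (hY : ∀ n, IsZonotope (Y n)) (hZ : ∀ n, IsZonotope (Z n))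
    (hA : Tendsto X atTop (𝓝 A)) (hB : Tendsto Y atTop (𝓝 B)) (hC : Tendsto Z atTop (𝓝 C)) :
    Tendsto (fun n => mixedVolume (X n) (Y n) (Z n)) atTop (𝓝 (mixedVolume A B C)) := by
  have hAB := ConvexBody.tendsto_add hA hB
  have hXY := fun n => (hX n).add (hY n)
  exact ((((((tendsto_bodyVol (fun n => (hXY n).add (hZ n)) (ConvexBody.tendsto_add hAB hC)).sub
    (tendsto_bodyVol hXY hAB)).sub
    (tendsto_bodyVol (fun n => (hX n).add (hZ n)) (ConvexBody.tendsto_add hA hC))).sub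
    (tendsto_bodyVol (fun n => (hY n).add (hZ n)) (ConvexBody.tendsto_add hB hC))).add
    (tendsto_bodyVol hX hA)).add (tendsto_bodyVol hY hB)).add (tendsto_bodyVol hZ hC)
    |>.div_const 6

theorem theorem1 (A B C : ConvexBody E3) (hA : IsZonoid A) (hB : IsZonoid B) (hC : IsZonoid C) :
    mixedVolume A A A * mixedVolume A B C ≤
      (3 / 2 : ℝ) * (mixedVolume A A B * mixedVolume A A C) := by
  obtain ⟨X, hX, hA⟩ := hA
  obtain ⟨Y, hY, hB⟩ := hB
  obtain ⟨Z, hZ, hC⟩ := hC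
  exact le_of_tendsto_of_tendsto'
    ((tendsto_mixedVolume hX hX hX hA hA hA).mul (tendsto_mixedVolume hX hY hZ hA hB hC))
    (((tendsto_mixedVolume hX hX hY hA hA hB).mul
      (tendsto_mixedVolume hX hX hZ hA hA hC)).const_mul _)
    fun n => mixedVolume_mul_le_of_isZonotope (hX n) (hY n) (hZ n)
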